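/- Let $G$ be a simple connected graph with vertex set $[n]=\{1,\dots,n\}$, edge set $E(G)$ and first Betti number $\beta(G)=|E(G)|-(n-1)$. Let $\mathcal S(n)$ and $\mathcal A(n)$ be the spaces of real symmetric and real anti-symmetric $n\times n$ matrices, and let $\mathcal S(G)\subseteq\mathcal S(n)$ be the subspace of matrices $A$ with $A_{ij}=0$ whenever $i\ne j$ and $(ij)\notin E(G)$. Call $A\in\mathcal S(G)$ strictly supported on $G$ if moreover $A_{ij}\neq 0$ for all $(ij)\in E(G)$. For $\varphi\in\mathbb R^n$ put $\nu(A,\varphi)=|\{i<j : A_{ij}\varphi(i)\varphi(j)>0\}|$. Let $A\in\mathcal S(G)$ be strictly supported on $G$ (repeated eigenvalues are allowed). We say that $A$ satisfies the transversality condition if $\{AX-XA : X\in\mathcal A(n)\}$ and $\mathcal S(G)$ together span $\mathcal S(n)$. If $A$ satisfies the transversality condition, then for every basis $\varphi_1,\dots,\varphi_n$ of $\mathbb R^n$ consisting of pairwise orthogonal eigenvectors of $A$ with $\varphi_k(i)\ne 0$ for all $i,k\in[n]$, $$\frac{\beta(G)}{n}\le\frac1n\sum_{k=1}^n\bigl[\nu(A,\varphi_k)-(k-1)\bigr]\le\beta(G)-\frac{\beta(G)}{n},$$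 and, equivalently, $$\frac{n-1}{2}+\frac{\beta(G)}{n}\le\frac1n\sum_{k=1}^n\nu(A,\varphi_k)\le\frac{n-1}{2}+\beta(G)-\frac{\beta(G)}{n}.$$ Explicitly: 1. The transversality condition is that $\mathcal S(G)+\{AX-XA : X\in\mathcal A(n)\}=\mathcal S(n)$. 2. A necessary condition for transversality is $\dim\mathcal S(G)+\dim\{AX-XA : X\in\mathcal A(n)\}\ge\dim\mathcal S(n)$. If $A$ has exactly $r$ distinct eigenvalues, of multiplicities $m_1,\dots,m_r$, then $\sum_{i=1}^r m_i=n$ and this dimension inequality is equivalent to $$|E(G)|=\beta(G)-1+n\ge\sum_{i=1}^r\binom{m_i}{2}.$$ In particular, the last inequality is necessary for transversality. -/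

import Mathlib

open scoped Matrix Pointwise

namespace NodalCount

variable {n : ℕ}

/-- The space `S(n)` of real symmetric matrices. -/
def symMatrices (n : ℕ) : Submodule ℝ (Matrix (Fin n) (Fin n) ℝ) where
  carrier := {A | A.IsSymm}
  add_mem' := fun ha hb => ha.add hb
  zero_mem' := Matrix.isSymm_zero
  smul_mem' := fun c _ ha => ha.smul c

/-- The space `A(n)` of real anti-symmetric matrices. -/
def antisymMatrices (n : ℕ) : Submodule ℝ (Matrix (Fin n) (Fin n) ℝ) where
  carrier := {X | Xᵀ = -X}
  add_mem' := by
    intro a b ha hb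
    simp only [Set.mem_ofPred_eq] at *
    rw [Matrix.transpose_add, ha, hb, neg_add]
  zero_mem' := by simp
  smul_mem' := by
    intro c a ha
    simp only [Set.mem_ofPred_eq] at *
    rw [Matrix.transpose_smul, ha, smul_neg]

/-- The space `S(G)` of real symmetric matrices supported on `G`: off-diagonal entries vanish at
non-edges, and the diagonal is unrestricted. -/
def supportedOn (G : SimpleGraph (Fin n)) : Submodule ℝ (Matrix (Fin n) (Fin n) ℝ) where
  carrier := {A | A.IsSymm ∧ ∀ i j, i ≠ j → ¬ G.Adj i j → A i j = 0}
  add_mem' := by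
    intro a b ha hb
    refine ⟨ha.1.add hb.1, fun i j hij h => ?_⟩
    simp [ha.2 i j hij h, hb.2 i j hij h]
  zero_mem' := ⟨Matrix.isSymm_zero, fun _ _ _ _ => rfl⟩
  smul_mem' := by
    intro c a ha
    refine ⟨ha.1.smul c, fun i j hij h => ?_⟩
    simp [ha.2 i j hij h]

/-- `A` is strictly supported on `G`: it lies in `S(G)` and does not vanish on any edge. -/
def IsStrictlySupportedOn (A : Matrix (Fin n) (Fin n) ℝ) (G : SimpleGraph (Fin n)) : Prop :=
  A ∈ supportedOn G ∧ ∀ i j, G.Adj i j → A i j ≠ 0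

/-- The linear map `X ↦ AX - XA`. -/
def commutatorMap (A : Matrix (Fin n) (Fin n) ℝ) :
    Matrix (Fin n) (Fin n) ℝ →ₗ[ℝ] Matrix (Fin n) (Fin n) ℝ :=
  LinearMap.mulLeft ℝ A - LinearMap.mulRight ℝ A

/-- The space `{AX - XA : X ∈ A(n)}`. -/
def orbitTangent (A : Matrix (Fin n) (Fin n) ℝ) : Submodule ℝ (Matrix (Fin n) (Fin n) ℝ) :=
  (antisymMatrices n).map (commutatorMap A)

/-- The transversality condition of `A` with respect to a subspace `W` of `S(n)`:
`{AX - XA : X ∈ A(n)} + W = S(n)`. -/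
def TransversalityCondition (A : Matrix (Fin n) (Fin n) ℝ)
    (W : Submodule ℝ (Matrix (Fin n) (Fin n) ℝ)) : Prop :=
  orbitTangent A ⊔ W = symMatrices n

/-- The number of edges. -/
noncomputable def numEdges (G : SimpleGraph (Fin n)) : ℕ := G.edgeSet.ncard

/-- The first Betti number `|E(G)| - (n - 1)` (of a connected graph), as an integer. -/
noncomputable def betti (G : SimpleGraph (Fin n)) : ℤ := (numEdges G : ℤ) - ((n : ℤ) - 1)

/-- The nodal edge count `|{i < j : A i j * φ i * φ j > 0}|`. -/
noncomputable def nodalCount (A : Matrix (Fin n) (Fin n) ℝ) (φ : Fin n → ℝ) : ℕ :=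
  {p : Fin n × Fin n | p.1 < p.2 ∧ 0 < A p.1 p.2 * φ p.1 * φ p.2}.ncard

/-- A basis of `ℝⁿ` made of pairwise orthogonal eigenvectors of `A` (of any positive lengths; the
nodal count does not depend on them). -/
structure IsOrthogonalEigenbasis (A : Matrix (Fin n) (Fin n) ℝ)
    (φ : Module.Basis (Fin n) ℝ (Fin n → ℝ)) : Prop where
  eigenvector : ∀ k, ∃ μ : ℝ, Module.End.HasEigenvector (Matrix.toLin' A) μ (φ k)
  orthogonal : ∀ k l, k ≠ l → φ k ⬝ᵥ φ l = 0

/-- The multiplicity of `μ` as an eigenvalue of `A`, the dimension of the eigenspace. -/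
noncomputable def multiplicity (A : Matrix (Fin n) (Fin n) ℝ) (μ : ℝ) : ℕ :=
  Module.finrank ℝ (Module.End.eigenspace (Matrix.toLin' A) μ)

end NodalCount

namespace NodalCount

variable {n : ℕ}

/-! Normalize the eigenvectors to the columns `φ_k` of an orthogonal matrix `U`, with eigenvalues
`d_k`. For each `k` consider the quadratic form on antisymmetric edge functions with weights `A i j
* φ_k i * φ_k j`; its positive coordinates are the edges counted by the nodal count. For `X`
symmetric and `a` antisymmetric, correct `a` by the gradient of `Xφ_k / φ_k`, a different gauge for
each `k`. The forms at these corrected functions add up to zero over `k` (`sum_edgeForm_eq_zero`).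

If all positive coordinates of the corrected functions vanish, every remaining term is nonpositive,
so all of them vanish and `a` is the gradient of `Xφ_k / φ_k` for every `k` at once. On a connected
graph the quotients `Xφ_k / φ_k` then differ only by constants, and a few normalizations force `X =
0` and `a = 0` (`gaugeConditions_injective`). Comparing the number of linear conditions with the
dimension of the space of pairs `(X, a)` gives the lower bound on the total nodal count. The upper
bound is the lower bound for `-A`, since each edge is counted for exactly one of `A` and `-A`.

For the dimension criterion, diagonalize `A`: the commutator with a diagonal matrix multiplies the
`(i, j)` entry by `d i - d j`, so the tangent space misses exactly the entries with equal
eigenvalues (`orbitTangent_eq_map`). Off the diagonal there are `∑ (m_i choose 2)` of these. -/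

/-! ### Dimensions of spaces of symmetric matrices and pair counting. -/

/-- The symmetric matrices whose entries vanish off the relation `r`. -/
def symSupport (r : Fin n → Fin n → Prop) : Submodule ℝ (Matrix (Fin n) (Fin n) ℝ) where
  carrier := {A | A.IsSymm ∧ ∀ i j, ¬ r i j → A i j = 0}
  add_mem' := by
    intro a b ha hb
    refine ⟨ha.1.add hb.1, fun i j h => ?_⟩
    simp [ha.2 i j h, hb.2 i j h]
  zero_mem' := ⟨Matrix.isSymm_zero, fun _ _ _ => rfl⟩
  smul_mem' := by
    intro c a ha
    refine ⟨ha.1.smul c, fun i j h => ?_⟩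
    simp [ha.2 i j h]

open Classical in
/-- A symmetric matrix is determined by its entries on and above the diagonal. -/
noncomputable def symSupportEquiv (r : Fin n → Fin n → Prop) (hr : ∀ i j, r i j → r j i) :
    symSupport r ≃ₗ[ℝ] ({p : Fin n × Fin n // p.1 ≤ p.2 ∧ r p.1 p.2} → ℝ) where
  toFun A p := A.1 p.1.1 p.1.2
  map_add' _ _ := rfl
  map_smul' _ _ := rfl
  invFun f := ⟨Matrix.of fun i j => if h : r i j then
      if hij : i ≤ j then f ⟨(i, j), hij, h⟩ else f ⟨(j, i), (not_le.1 hij).le, hr i j h⟩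
      else 0, by
    refine ⟨?_, fun i j h => by simp [h]⟩
    ext i j
    rw [Matrix.transpose_apply, Matrix.of_apply, Matrix.of_apply]
    by_cases h : r i j
    · have h' := hr i j h
      rcases lt_trichotomy i j with hij | rfl | hij
      · simp [h, h', hij.le, not_le.2 hij]
      · rfl
      · simp [h, h', hij.le, not_le.2 hij]
    · have h' : ¬ r j i := fun h' => h (hr j i h')
      simp [h, h']⟩
  left_inv A := by
    ext i j
    by_cases h : r i j
    · by_cases hij : i ≤ j
      · simp [h, hij]
      · simpa [h, hij] using A.2.1.apply i j
    · simpa [h] using (A.2.2 i j h).symm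
  right_inv f := by
    ext p
    simp [p.2.1, p.2.2]

theorem finrank_symSupport (r : Fin n → Fin n → Prop) (hr : ∀ i j, r i j → r j i) :
    Module.finrank ℝ (symSupport r) = Nat.card {p : Fin n × Fin n // p.1 ≤ p.2 ∧ r p.1 p.2} := by
  classical
  rw [(symSupportEquiv r hr).finrank_eq, Module.finrank_fintype_fun_eq_card,
    Nat.card_eq_fintype_card]

theorem symMatrices_eq_symSupport : symMatrices n = symSupport fun _ _ => True := by
  ext A
  exact ⟨fun h => ⟨h, fun _ _ h' => (h' trivial).elim⟩, fun h => h.1⟩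

theorem supportedOn_eq_symSupport (G : SimpleGraph (Fin n)) :
    supportedOn G = symSupport fun i j => i = j ∨ G.Adj i j := by
  ext A
  refine ⟨fun h => ⟨h.1, fun i j h' => ?_⟩, fun h => ⟨h.1, fun i j hij h' => ?_⟩⟩
  · push Not at h'
    exact h.2 i j h'.1 h'.2
  · exact h.2 i j (by tauto)

/-- The number of edges, counted as pairs `i < j`. -/
theorem numEdges_eq_card (G : SimpleGraph (Fin n)) :
    numEdges G = Nat.card {p : Fin n × Fin n // p.1 < p.2 ∧ G.Adj p.1 p.2} := by
  rw [numEdges, ← Nat.card_coe_set_eq]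
  symm
  refine Nat.card_eq_of_bijective
    (fun p => (⟨s(p.1.1, p.1.2), p.2.2⟩ : G.edgeSet)) ⟨?_, ?_⟩
  · rintro ⟨⟨a, b⟩, hab, h⟩ ⟨⟨c, d⟩, hcd, h'⟩ he
    rcases Sym2.eq_iff.1 (Subtype.mk.inj he) with ⟨rfl, rfl⟩ | ⟨rfl, rfl⟩
    · rfl
    · exact absurd hab (not_lt.2 (le_of_lt hcd))
  · rintro ⟨e, he⟩
    induction e using Sym2.ind with
    | _ a b =>
      have hab : G.Adj a b := he
      rcases lt_or_gt_of_ne hab.ne with h | h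
      · exact ⟨⟨(a, b), h, hab⟩, rfl⟩
      · exact ⟨⟨(b, a), h, hab.symm⟩, Subtype.ext Sym2.eq_swap⟩

/-- Splitting off the diagonal when counting pairs. -/
theorem card_le_eq_card_lt_add (r : Fin n → Fin n → Prop) :
    Nat.card {p : Fin n × Fin n // p.1 ≤ p.2 ∧ (p.1 = p.2 ∨ r p.1 p.2)} =
      n + Nat.card {p : Fin n × Fin n // p.1 < p.2 ∧ r p.1 p.2} := by
  classical
  simp only [Nat.card_eq_fintype_card, Fintype.card_subtype]
  have h1 : (Finset.univ.filter fun p : Fin n × Fin n => p.1 ≤ p.2 ∧ (p.1 = p.2 ∨ r p.1 p.2)) =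
      (Finset.univ.filter fun p : Fin n × Fin n => p.1 = p.2) ∪
        Finset.univ.filter fun p : Fin n × Fin n => p.1 < p.2 ∧ r p.1 p.2 := by
    ext p
    simp only [Finset.mem_filter, Finset.mem_univ, true_and, Finset.mem_union]
    constructor
    · rintro ⟨h, h' | h'⟩
      · exact Or.inl h'
      · rcases h.eq_or_lt with h | h
        · exact Or.inl h
        · exact Or.inr ⟨h, h'⟩
    · rintro (h | ⟨h, h'⟩)
      · exact ⟨h.le, Or.inl h⟩
      · exact ⟨h.le, Or.inr h'⟩
  rw [h1, Finset.card_union_of_disjoint]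
  · congr 1
    rw [← Fintype.card_subtype]
    conv_rhs => rw [← Fintype.card_fin n]
    exact Fintype.card_congr ⟨fun p => p.1.1, fun i => ⟨(i, i), rfl⟩,
      fun ⟨⟨a, b⟩, h⟩ => Subtype.ext (Prod.ext rfl h), fun _ => rfl⟩
  · rw [Finset.disjoint_filter]
    exact fun p _ h h' => h'.1.ne h

/-- The number of pairs `i < j` in a set of size `m` is `m.choose 2`. -/
theorem card_lt_pairs (s : Finset (Fin n)) :
    (Finset.univ.filter fun p : Fin n × Fin n => p.1 < p.2 ∧ p.1 ∈ s ∧ p.2 ∈ s).card =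
      s.card.choose 2 := by
  -- Swapping coordinates matches the two halves of the off-diagonal, so each has `m * (m - 1) / 2`
  -- elements.
  have h : (s.offDiag.filter fun p => p.2 < p.1).card =
      (s.offDiag.filter fun p => p.1 < p.2).card :=
    Finset.card_bij (fun p _ => p.swap) (by simp; tauto) (by simp) (by
      rintro ⟨a, b⟩ h
      refine ⟨(b, a), ?_, rfl⟩
      simp at h ⊢
      tauto)
  have h2 := Finset.card_filter_add_card_filter_not (s := s.offDiag) (fun p => p.1 < p.2)
  have h3 : (s.offDiag.filter fun p => ¬ p.1 < p.2) = s.offDiag.filter fun p => p.2 < p.1 := by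
    apply Finset.filter_congr
    intro p hp
    have := (Finset.mem_offDiag.1 hp).2.2
    exact ⟨fun h => lt_of_le_of_ne (not_lt.1 h) this.symm, fun h => not_lt.2 h.le⟩
  have h4 : (Finset.univ.filter fun p : Fin n × Fin n => p.1 < p.2 ∧ p.1 ∈ s ∧ p.2 ∈ s) =
      s.offDiag.filter fun p => p.1 < p.2 := by
    ext p
    simp only [Finset.mem_filter, Finset.mem_univ, true_and, Finset.mem_offDiag]
    exact ⟨fun ⟨h, h', h''⟩ => ⟨⟨h', h'', h.ne⟩, h⟩, fun ⟨⟨h', h'', _⟩, h⟩ => ⟨h, h', h''⟩⟩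
  rw [h3] at h2
  rw [h4, Nat.choose_two_right, Nat.mul_sub, mul_one, ← Finset.offDiag_card]
  omega

theorem card_lt_pairs_univ (n : ℕ) :
    Nat.card {p : Fin n × Fin n // p.1 < p.2 ∧ True} = n.choose 2 := by
  rw [Nat.card_eq_fintype_card, Fintype.card_subtype]
  simpa using card_lt_pairs (Finset.univ : Finset (Fin n))

theorem finrank_symMatrices : Module.finrank ℝ (symMatrices n) = n + n.choose 2 := by
  rw [symMatrices_eq_symSupport, finrank_symSupport _ (fun _ _ _ => trivial),
    ← card_lt_pairs_univ,
    ← card_le_eq_card_lt_add fun _ _ => True]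
  simp

theorem finrank_supportedOn (G : SimpleGraph (Fin n)) :
    Module.finrank ℝ (supportedOn G) = n + numEdges G := by
  rw [supportedOn_eq_symSupport, finrank_symSupport, numEdges_eq_card, card_le_eq_card_lt_add]
  rintro i j (h | h)
  · exact Or.inl h.symm
  · exact Or.inr h.symm

/-! ### The vanishing sum of edge forms. -/

/-- The signed quadratic forms on edge functions attached to an orthonormal eigenbasis (the columns
of `U`) add up to zero on pairs of a symmetric matrix `X` and an antisymmetric edge function `a`. -/
theorem sum_edgeForm_eq_zero {A U X a : Matrix (Fin n) (Fin n) ℝ} {d : Fin n → ℝ}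
    (hA : A.IsSymm) (hU : U * Uᵀ = 1) (hAU : A * U = U * Matrix.diagonal d)
    (hU0 : ∀ i k, U i k ≠ 0) (hX : X.IsSymm) (ha : aᵀ = -a) :
    ∑ k, ∑ i, ∑ j, A i j * U i k * U j k *
      (a i j - (X * U) i k / U i k + (X * U) j k / U j k) ^ 2 = 0 := by
  set Z := X * U with hZ
  have ha' : ∀ i j, a j i = -a i j := fun i j => congrFun (congrFun ha i) j
  have hA' : ∀ i j, A j i = A i j := fun i j => hA.apply i j
  have hUU : ∀ i j, ∑ k, U i k * U j k = if i = j then 1 else 0 := fun i j => by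
    simpa [Matrix.mul_apply, Matrix.one_apply] using congrFun (congrFun hU i) j
  have hAU' : ∀ i k, ∑ j, A i j * U j k = d k * U i k := fun i k => by
    have h := congrFun (congrFun hAU i) k
    rwa [Matrix.mul_diagonal, Matrix.mul_apply, mul_comm (U i k)] at h
  have hZU : Z * Uᵀ = X := by rw [hZ, Matrix.mul_assoc, hU, Matrix.mul_one]
  have hZU' : ∀ i j, ∑ k, Z i k * U j k = X i j := fun i j => by
    simpa [Matrix.mul_apply] using congrFun (congrFun hZU i) j
  -- After expansion the `a²` part dies by orthogonality of the rows of `U`, the cross terms cancel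
  -- because `X` is symmetric, and the part quadratic in `Z` is `2 tr(AX²) - 2 tr(AX²)`. One factor
  -- is written `A j i` so that `e3` is `e2` with the indices exchanged.
  have hterm : ∀ k i j, A i j * U i k * U j k *
      (a i j - Z i k / U i k + Z j k / U j k) ^ 2 =
      A i j * a i j ^ 2 * (U i k * U j k) + (A i j * U j k) * (Z i k ^ 2 / U i k)
      + (A j i * U i k) * (Z j k ^ 2 / U j k) - 2 * (A i j * a i j) * (Z i k * U j k)
      + 2 * (A i j * a i j) * (Z j k * U i k) - 2 * (Z i k * A i j * Z j k) := by
    intro k i j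
    have h1 := hU0 i k
    have h2 := hU0 j k
    rw [hA' i j]
    field_simp
    ring
  have e1 : ∑ k, ∑ i, ∑ j, A i j * a i j ^ 2 * (U i k * U j k) = 0 := by
    rw [Finset.sum_comm]
    refine Finset.sum_eq_zero fun i _ => ?_
    rw [Finset.sum_comm]
    refine Finset.sum_eq_zero fun j _ => ?_
    rw [← Finset.mul_sum, hUU]
    split_ifs with h
    · subst h
      have := ha' i i
      have : a i i = 0 := by linarith
      simp [this]
    · simp
  have e2 : ∑ k, ∑ i, ∑ j, (A i j * U j k) * (Z i k ^ 2 / U i k) = ∑ k, ∑ i, d k * Z i k ^ 2 := by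
    refine Finset.sum_congr rfl fun k _ => Finset.sum_congr rfl fun i _ => ?_
    rw [← Finset.sum_mul, hAU']
    have := hU0 i k
    field_simp
  have e3 : ∑ k, ∑ i, ∑ j, (A j i * U i k) * (Z j k ^ 2 / U j k) = ∑ k, ∑ i, d k * Z i k ^ 2 := by
    rw [← e2]
    exact Finset.sum_congr rfl fun k _ => Finset.sum_comm
  have e4 : ∑ k, ∑ i, ∑ j, 2 * (A i j * a i j) * (Z i k * U j k) =
      ∑ i, ∑ j, 2 * (A i j * a i j) * X i j := by
    rw [Finset.sum_comm]
    refine Finset.sum_congr rfl fun i _ => ?_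
    rw [Finset.sum_comm]
    refine Finset.sum_congr rfl fun j _ => ?_
    rw [← Finset.mul_sum, hZU']
  have e5 : ∑ k, ∑ i, ∑ j, 2 * (A i j * a i j) * (Z j k * U i k) =
      ∑ i, ∑ j, 2 * (A i j * a i j) * X i j := by
    rw [Finset.sum_comm]
    refine Finset.sum_congr rfl fun i _ => ?_
    rw [Finset.sum_comm]
    refine Finset.sum_congr rfl fun j _ => ?_
    rw [← Finset.mul_sum, hZU', hX.apply i j]
  -- Both sides are `2 tr(AX²)`, by `Z * Zᵀ = X * X`, `U * diagonal d = A * U` and cyclicity of the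
  -- trace.
  have e6 : ∑ k, ∑ i, ∑ j, 2 * (Z i k * A i j * Z j k) = 2 * ∑ k, ∑ i, d k * Z i k ^ 2 := by
    have t1 : ∑ k, ∑ i, ∑ j, Z i k * A i j * Z j k = (Zᵀ * A * Z).trace := by
      simp only [Matrix.trace, Matrix.diag_apply, Matrix.mul_apply, Matrix.transpose_apply,
        Finset.sum_mul]
      exact Finset.sum_congr rfl fun k _ => Finset.sum_comm
    have t2 : ∑ k, ∑ i, d k * Z i k ^ 2 = (Zᵀ * (Z * Matrix.diagonal d)).trace := by
      simp only [Matrix.trace, Matrix.diag_apply, Matrix.mul_apply (M := Zᵀ),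
        Matrix.transpose_apply, Matrix.mul_diagonal]
      exact Finset.sum_congr rfl fun k _ => Finset.sum_congr rfl fun i _ => by ring
    have t0 : ∑ k, ∑ i, ∑ j, 2 * (Z i k * A i j * Z j k) =
        2 * ∑ k, ∑ i, ∑ j, Z i k * A i j * Z j k := by
      simp only [← Finset.mul_sum]
    have hZT : Z * Zᵀ = X * X := by
      rw [show Zᵀ = Uᵀ * X by rw [hZ, Matrix.transpose_mul, hX.eq], ← Matrix.mul_assoc, hZU]
    rw [t0, t1, t2, Matrix.mul_assoc, Matrix.trace_mul_comm, Matrix.mul_assoc, hZT,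
      Matrix.trace_mul_comm Zᵀ, hZ, Matrix.mul_assoc X U, ← hAU, Matrix.mul_assoc,
      show Zᵀ = Uᵀ * X by rw [hZ, Matrix.transpose_mul, hX.eq],
      Matrix.mul_assoc, ← Matrix.mul_assoc U, hU, Matrix.one_mul, Matrix.trace_mul_comm X,
      Matrix.mul_assoc]
  simp only [hterm, Finset.sum_add_distrib, Finset.sum_sub_distrib]
  rw [e1, e2, e3, e4, e5, e6]
  ring

/-! ### Gauge conditions and the dimension count. -/

/-- The antisymmetric matrix with the same entries above the diagonal as `S`. -/
def antisymmetrize (S : Matrix (Fin n) (Fin n) ℝ) : Matrix (Fin n) (Fin n) ℝ :=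
  Matrix.of fun i j => if i < j then S i j else if j < i then - S i j else 0

theorem antisymmetrize_transpose {S : Matrix (Fin n) (Fin n) ℝ} (hS : S.IsSymm) :
    (antisymmetrize S)ᵀ = -antisymmetrize S := by
  ext i j
  have := hS.apply i j
  rcases lt_trichotomy i j with h | rfl | h
  · simp [antisymmetrize, h, not_lt_of_gt h, this]
  · simp [antisymmetrize]
  · simp [antisymmetrize, h, not_lt_of_gt h, this]

/-- The edge function `a` corrected by the gradient of `X φ_k / φ_k`, where `φ_k` is the `k`-th
column of `U`. -/
noncomputable def gaugedEdge (U X a : Matrix (Fin n) (Fin n) ℝ) (k i j : Fin n) : ℝ :=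
  a i j - (X * U) i k / U i k + (X * U) j k / U j k

theorem gaugedEdge_swap {U X a : Matrix (Fin n) (Fin n) ℝ} (ha : aᵀ = -a) (k i j : Fin n) :
    gaugedEdge U X a k j i = -gaugedEdge U X a k i j := by
  have : a j i = -a i j := congrFun (congrFun ha i) j
  rw [gaugedEdge, gaugedEdge, this]
  ring

/-- The index set of the positive coordinates of the `k`-th edge form. -/
abbrev PositivePairs (A U : Matrix (Fin n) (Fin n) ℝ) (k : Fin n) :=
  {p : Fin n × Fin n // p.1 < p.2 ∧ 0 < A p.1 p.2 * U p.1 k * U p.2 k}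

/-- The linear conditions which cut a pair (symmetric matrix, edge function) down to zero. -/
noncomputable def gaugeConditions (G : SimpleGraph (Fin n)) (A U : Matrix (Fin n) (Fin n) ℝ)
    (o : Fin n) :
    (symMatrices n × supportedOn G) →ₗ[ℝ]
      (((Σ k, PositivePairs A U k) → ℝ) × (Fin n → ℝ)) × (({i : Fin n // i ≠ o} → ℝ) ×
        (Fin n → ℝ)) where
  toFun q := ((fun s => gaugedEdge U q.1.1 (antisymmetrize q.2.1) s.1 s.2.1.1 s.2.1.2,
    fun k => (q.1.1 * U) o k), (fun i => q.1.1 i.1 i.1, fun i => q.2.1 i i))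
  map_add' x y := by
    refine Prod.ext (Prod.ext ?_ ?_) (Prod.ext rfl rfl)
    · ext s
      have := s.2.2.1
      simp [gaugedEdge, antisymmetrize, this, Matrix.add_mul]
      ring
    · ext s
      simp [Matrix.add_mul]
  map_smul' c x := by
    refine Prod.ext (Prod.ext ?_ ?_) (Prod.ext rfl rfl)
    · ext s
      have := s.2.2.1
      simp [gaugedEdge, antisymmetrize, this]
      ring
    · ext s
      simp

/-- With the positive coordinates killed, a sum of nonpositive terms equals zero, so each term is
zero; on an edge the weight is nonzero, hence the square vanishes. -/
theorem gaugedEdge_eq_zero {G : SimpleGraph (Fin n)} {A U X a : Matrix (Fin n) (Fin n) ℝ}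
    {d : Fin n → ℝ} (hA : IsStrictlySupportedOn A G) (hU : U * Uᵀ = 1)
    (hAU : A * U = U * Matrix.diagonal d) (hU0 : ∀ i k, U i k ≠ 0) (hX : X.IsSymm)
    (ha : aᵀ = -a)
    (hpos : ∀ k i j, i < j → 0 < A i j * U i k * U j k → gaugedEdge U X a k i j = 0)
    {i j : Fin n} (hij : G.Adj i j) (k : Fin n) : gaugedEdge U X a k i j = 0 := by
  have hsum := sum_edgeForm_eq_zero hA.1.1 hU hAU hU0 hX ha
  have hterm : ∀ k i j, A i j * U i k * U j k *
      (a i j - (X * U) i k / U i k + (X * U) j k / U j k) ^ 2 ≤ 0 := by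
    intro k i j
    change _ * gaugedEdge U X a k i j ^ 2 ≤ 0
    rcases le_or_gt (A i j * U i k * U j k) 0 with h | h
    · exact mul_nonpos_of_nonpos_of_nonneg h (sq_nonneg _)
    -- The hypothesis covers only `i < j`; antisymmetry handles the diagonal and the reversed pairs.
    · rcases lt_trichotomy i j with h' | rfl | h'
      · simp [hpos k i j h' h]
      · have := gaugedEdge_swap (U := U) (X := X) ha k i i
        have h0 : gaugedEdge U X a k i i = 0 := by linarith
        simp [h0]
      · have := hpos k j i h' (by rw [hA.1.1.apply i j, mul_right_comm]; exact h)
        rw [gaugedEdge_swap ha, neg_eq_zero] at this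
        simp [this]
  have h1 := (Finset.sum_eq_zero_iff_of_nonpos fun k _ => Finset.sum_nonpos fun i _ =>
    Finset.sum_nonpos fun j _ => hterm k i j).1 hsum k (Finset.mem_univ _)
  have h2 := (Finset.sum_eq_zero_iff_of_nonpos fun i _ =>
    Finset.sum_nonpos fun j _ => hterm k i j).1 h1 i (Finset.mem_univ _)
  have h3 := (Finset.sum_eq_zero_iff_of_nonpos fun j _ => hterm k i j).1 h2 j (Finset.mem_univ _)
  exact (pow_eq_zero_iff two_ne_zero).1
    ((mul_eq_zero.1 h3).resolve_left (mul_ne_zero (mul_ne_zero (hA.2 i j hij) (hU0 i k)) (hU0 j k)))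

theorem eq_of_forall_adj {G : SimpleGraph (Fin n)} (hG : G.Connected) {f : Fin n → ℝ}
    (hf : ∀ i j, G.Adj i j → f i = f j) (i j : Fin n) : f i = f j := by
  obtain ⟨p⟩ := hG.preconnected i j
  induction p with
  | nil => rfl
  | cons h _ ih => exact (hf _ _ h).trans ih

/-- The corrected functions vanish on all edges, which makes `Xφ_k / φ_k` independent of `k`. Every
`φ_k` is then an eigenvector of one diagonal matrix composed with nothing else, that is, `X` is that
diagonal matrix, and the normalizations make it zero. -/
theorem gaugeConditions_injective {G : SimpleGraph (Fin n)} (hG : G.Connected)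
    {A U : Matrix (Fin n) (Fin n) ℝ} {d : Fin n → ℝ} (hA : IsStrictlySupportedOn A G)
    (hU : U * Uᵀ = 1) (hAU : A * U = U * Matrix.diagonal d) (hU0 : ∀ i k, U i k ≠ 0)
    (o : Fin n) : Function.Injective (gaugeConditions G A U o) := by
  rw [injective_iff_map_eq_zero]
  rintro ⟨⟨X, hX⟩, ⟨S, hS⟩⟩ h0
  replace hX : X.IsSymm := hX
  have hpos : ∀ k i j, i < j → 0 < A i j * U i k * U j k →
      gaugedEdge U X (antisymmetrize S) k i j = 0 := fun k i j hij h =>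
    congrFun (congrArg (fun q => q.1.1) h0) ⟨k, ⟨(i, j), hij, h⟩⟩
  have hrow : ∀ k, (X * U) o k = 0 := fun k => congrFun (congrArg (fun q => q.1.2) h0) k
  have hXd : ∀ i, i ≠ o → X i i = 0 := fun i hi =>
    congrFun (congrArg (fun q => q.2.1) h0) ⟨i, hi⟩
  have hSd : ∀ i, S i i = 0 := fun i => congrFun (congrArg (fun q => q.2.2) h0) i
  have hadj : ∀ k i j, G.Adj i j → gaugedEdge U X (antisymmetrize S) k i j = 0 := fun k i j hij =>
    gaugedEdge_eq_zero hA hU hAU hU0 hX (antisymmetrize_transpose hS.1) hpos hij k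
  -- Subtracting the edge equations for the indices `k` and `o` eliminates `a`, so the difference of
  -- quotients is constant; it vanishes at the vertex `o`. Here `o` serves both as base vertex and
  -- as reference eigenvector.
  have hy : ∀ i k, (X * U) i k / U i k = (X * U) i o / U i o := by
    intro i k
    have := eq_of_forall_adj hG (f := fun i => (X * U) i k / U i k - (X * U) i o / U i o)
      (fun i j hij => by
        have h1 := hadj k i j hij
        have h2 := hadj o i j hij
        simp only [gaugedEdge] at h1 h2
        linarith) i o
    simp only [hrow, zero_div, sub_zero] at this
    linarith
  have hXU : X * U = Matrix.diagonal (fun i => (X * U) i o / U i o) * U := by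
    ext i k
    rw [Matrix.diagonal_mul, ← hy i k, div_mul_cancel₀ _ (hU0 i k)]
  have hXdiag : X = Matrix.diagonal (fun i => (X * U) i o / U i o) := by
    have := congrArg (· * Uᵀ) hXU
    simpa only [Matrix.mul_assoc, hU, Matrix.mul_one] using this
  have hX0 : X = 0 := by
    -- At the vertex `o` the row condition already suffices, so only `n - 1` diagonal conditions are
    -- imposed. This saving is the `+ 1` in the final bound.
    have hz : ∀ i, (X * U) i o / U i o = 0 := by
      intro i
      by_cases hi : i = o
      · rw [hi, hrow, zero_div]
      · have := hXd i hi
        rwa [hXdiag, Matrix.diagonal_apply_eq] at this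
    rw [hXdiag]
    ext i j
    simp only [hz]
    simp
  subst hX0
  have hS0 : S = 0 := by
    have hlt : ∀ i j, i < j → S i j = 0 := by
      intro i j hij
      by_cases h : G.Adj i j
      · simpa [gaugedEdge, antisymmetrize, hij] using hadj o i j h
      · exact hS.2 i j hij.ne h
    ext i j
    rcases lt_trichotomy i j with h | rfl | h
    · exact hlt i j h
    · exact hSd i
    · rw [← hS.1.apply i j]
      exact hlt j i h
  subst hS0
  rfl

/-- The source of the injective map has dimension `(n + n.choose 2) + (n + |E|)`. The target has the
number of positive pairs, plus `n` for the row at `o`, `n - 1` for the diagonal of `X` and `n` for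
the diagonal of `S`, which carries no edge data. -/
theorem choose_two_add_numEdges_le {G : SimpleGraph (Fin n)} (hG : G.Connected)
    {A U : Matrix (Fin n) (Fin n) ℝ} {d : Fin n → ℝ} (hA : IsStrictlySupportedOn A G)
    (hU : U * Uᵀ = 1) (hAU : A * U = U * Matrix.diagonal d) (hU0 : ∀ i k, U i k ≠ 0) :
    n.choose 2 + numEdges G + 1 ≤ ∑ k, Nat.card (PositivePairs A U k) + n := by
  classical
  unfold PositivePairs
  obtain ⟨o⟩ := hG.nonempty
  have h := LinearMap.finrank_le_finrank_of_injective
    (gaugeConditions_injective hG hA hU hAU hU0 o)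
  simp only [Module.finrank_prod, finrank_symMatrices, finrank_supportedOn,
    Module.finrank_fintype_fun_eq_card, Fintype.card_sigma, Fintype.card_fin,
    ← Nat.card_eq_fintype_card (α := {p : Fin n × Fin n // _})] at h
  have hc : Fintype.card {i : Fin n // i ≠ o} + 1 = n := by
    have := Fintype.card_subtype_compl (fun i : Fin n => i = o)
    have ho := o.pos
    simp only [Fintype.card_fin, Fintype.card_subtype_eq] at this
    change Fintype.card {i : Fin n // ¬ i = o} + 1 = n
    omega
  omega

/-! ### Bounds on the total nodal count. -/

/-- The lower bound on the total nodal count of an orthogonal eigenbasis without zeros. -/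
theorem choose_two_add_numEdges_le_sum_nodalCount {G : SimpleGraph (Fin n)} (hG : G.Connected)
    {A : Matrix (Fin n) (Fin n) ℝ} (hA : IsStrictlySupportedOn A G)
    {φ : Module.Basis (Fin n) ℝ (Fin n → ℝ)} (hφ : IsOrthogonalEigenbasis A φ)
    (hφ0 : ∀ k i, φ k i ≠ 0) :
    n.choose 2 + numEdges G + 1 ≤ ∑ k, nodalCount A (φ k) + n := by
  have hN : ∀ k, 0 < φ k ⬝ᵥ φ k := fun k =>
    lt_of_le_of_ne (Finset.sum_nonneg fun i _ => mul_self_nonneg _)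
      (fun h => φ.ne_zero k (dotProduct_self_eq_zero.1 h.symm))
  choose d hd using hφ.eigenvector
  set s : Fin n → ℝ := fun k => √(φ k ⬝ᵥ φ k)
  have hs : ∀ k, 0 < s k := fun k => Real.sqrt_pos.2 (hN k)
  set U : Matrix (Fin n) (Fin n) ℝ := Matrix.of fun i k => φ k i / s k with hUdef
  have hU : U * Uᵀ = 1 := by
    rw [mul_eq_one_comm]
    ext k l
    have e : (Uᵀ * U) k l = (φ k ⬝ᵥ φ l) / (s k * s l) := by
      simp only [Matrix.mul_apply, Matrix.transpose_apply, hUdef, Matrix.of_apply, dotProduct,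
        Finset.sum_div]
      exact Finset.sum_congr rfl fun i _ => div_mul_div_comm _ _ _ _
    rw [e]
    by_cases h : k = l
    · subst h
      rw [Matrix.one_apply_eq, Real.mul_self_sqrt (hN k).le, div_self (hN k).ne']
    · rw [Matrix.one_apply_ne h, hφ.orthogonal k l h, zero_div]
  have hAU : A * U = U * Matrix.diagonal d := by
    ext i k
    have h := congrFun (hd k).apply_eq_smul i
    rw [Matrix.toLin'_apply, Matrix.mulVec, dotProduct, Pi.smul_apply, smul_eq_mul] at h
    rw [Matrix.mul_diagonal, Matrix.mul_apply]
    simp only [hUdef, Matrix.of_apply, ← mul_div_assoc]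
    rw [← Finset.sum_div, h]
    ring
  have hU0 : ∀ i k, U i k ≠ 0 := fun i k => div_ne_zero (hφ0 k i) (hs k).ne'
  refine (choose_two_add_numEdges_le hG hA hU hAU hU0).trans_eq ?_
  congr 1
  refine Finset.sum_congr rfl fun k _ => ?_
  rw [nodalCount, ← Nat.card_coe_set_eq]
  refine Nat.card_congr (Equiv.subtypeEquivRight fun p => and_congr_right fun _ => ?_)
  -- Normalizing divides each weight by a positive number, so its sign is unchanged.
  have : A p.1 p.2 * U p.1 k * U p.2 k = A p.1 p.2 * φ k p.1 * φ k p.2 / (s k * s k) := by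
    simp only [hUdef, Matrix.of_apply]
    ring
  rw [this]
  exact div_pos_iff_of_pos_right (mul_pos (hs k) (hs k))

theorem IsStrictlySupportedOn.neg {G : SimpleGraph (Fin n)} {A : Matrix (Fin n) (Fin n) ℝ}
    (hA : IsStrictlySupportedOn A G) : IsStrictlySupportedOn (-A) G :=
  ⟨neg_mem hA.1, fun i j h => neg_ne_zero.2 (hA.2 i j h)⟩

theorem IsOrthogonalEigenbasis.neg {A : Matrix (Fin n) (Fin n) ℝ}
    {φ : Module.Basis (Fin n) ℝ (Fin n → ℝ)} (hφ : IsOrthogonalEigenbasis A φ) :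
    IsOrthogonalEigenbasis (-A) φ := by
  refine ⟨fun k => ?_, hφ.orthogonal⟩
  obtain ⟨μ, hμ⟩ := hφ.eigenvector k
  refine ⟨-μ, Module.End.mem_eigenspace_iff.2 ?_, hμ.2⟩
  rw [map_neg, LinearMap.neg_apply, hμ.apply_eq_smul, neg_smul]

/-- Every edge is counted either for `A` or for `-A`. -/
theorem nodalCount_add_nodalCount_neg {G : SimpleGraph (Fin n)} {A : Matrix (Fin n) (Fin n) ℝ}
    (hA : IsStrictlySupportedOn A G) {φ : Fin n → ℝ} (hφ : ∀ i, φ i ≠ 0) :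
    nodalCount A φ + nodalCount (-A) φ = numEdges G := by
  rw [numEdges_eq_card, nodalCount, nodalCount, ← Set.ncard_union_eq]
  · rw [← Nat.card_coe_set_eq]
    refine Nat.card_congr (Equiv.subtypeEquivRight fun p => ?_)
    simp only [Set.mem_union, Set.mem_ofPred_eq, Matrix.neg_apply, neg_mul, Left.neg_pos_iff]
    rw [← and_or_left]
    refine and_congr_right fun hp => ⟨fun h => ?_, fun h => ?_⟩
    · by_contra h'
      simp [hA.1.2 _ _ hp.ne h'] at h
    · exact (mul_ne_zero (mul_ne_zero (hA.2 _ _ h) (hφ _)) (hφ _)).symm.lt_or_gt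
  · rw [Set.disjoint_left]
    rintro p ⟨_, h⟩ ⟨_, h'⟩
    simp only [Matrix.neg_apply, neg_mul, Left.neg_pos_iff] at h'
    exact lt_asymm h h'

/-- The upper bound on the total nodal count of an orthogonal eigenbasis without zeros. -/
theorem sum_nodalCount_le {G : SimpleGraph (Fin n)} (hG : G.Connected)
    {A : Matrix (Fin n) (Fin n) ℝ} (hA : IsStrictlySupportedOn A G)
    {φ : Module.Basis (Fin n) ℝ (Fin n → ℝ)} (hφ : IsOrthogonalEigenbasis A φ)
    (hφ0 : ∀ k i, φ k i ≠ 0) :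
    ∑ k, nodalCount A (φ k) + n.choose 2 + numEdges G + 1 ≤ n * numEdges G + n := by
  have h := choose_two_add_numEdges_le_sum_nodalCount hG hA.neg hφ.neg hφ0
  have h' : ∑ k, nodalCount A (φ k) + ∑ k, nodalCount (-A) (φ k) = n * numEdges G := by
    rw [← Finset.sum_add_distrib,
      Finset.sum_congr rfl fun k _ => nodalCount_add_nodalCount_neg hA (hφ0 k)]
    simp
  omega

/-! ### Orthogonal diagonalization and multiplicities. -/

theorem exists_orthogonal_diagonalization {A : Matrix (Fin n) (Fin n) ℝ} (hA : A.IsSymm) :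
    ∃ (U : Matrix (Fin n) (Fin n) ℝ) (d : Fin n → ℝ),
      U * Uᵀ = 1 ∧ Uᵀ * U = 1 ∧ A = U * Matrix.diagonal d * Uᵀ := by
  have hA' : A.IsHermitian := by
    rw [Matrix.IsHermitian, Matrix.conjTranspose_eq_transpose_of_trivial, hA.eq]
  have hT : star (hA'.eigenvectorUnitary : Matrix (Fin n) (Fin n) ℝ) =
      (hA'.eigenvectorUnitary : Matrix (Fin n) (Fin n) ℝ)ᵀ :=
    Matrix.conjTranspose_eq_transpose_of_trivial _
  refine ⟨hA'.eigenvectorUnitary, hA'.eigenvalues, ?_, ?_, ?_⟩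
  · rw [← hT, Unitary.mul_star_self_of_mem hA'.eigenvectorUnitary.2]
  · rw [← hT, Unitary.star_mul_self_of_mem hA'.eigenvectorUnitary.2]
  · have h := hA'.spectral_theorem
    rw [Unitary.conjStarAlgAut_apply, hT] at h
    exact h

/-- The multiplicity of `μ` is the number of its occurrences on the diagonal. -/
theorem multiplicity_eq_card {A U : Matrix (Fin n) (Fin n) ℝ} {d : Fin n → ℝ}
    (hU : U * Uᵀ = 1) (hA : A = U * Matrix.diagonal d * Uᵀ) (μ : ℝ) :
    multiplicity A μ = (Finset.univ.filter fun k => d k = μ).card := by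
  -- The eigenspace is the kernel of a conjugate of `diagonal (d - μ)`, whose rank counts the `k`
  -- with `d k ≠ μ`.
  have hshift : Matrix.toLin' A - μ • (1 : Module.End ℝ (Fin n → ℝ)) =
      Matrix.toLin' (U * Matrix.diagonal (fun k => d k - μ) * Uᵀ) := by
    have h1 : Matrix.diagonal (fun k => d k - μ) = Matrix.diagonal d - μ • 1 := by
      rw [Matrix.smul_one_eq_diagonal, Matrix.diagonal_sub]
    rw [h1, Matrix.mul_sub, Matrix.sub_mul, ← hA, Matrix.mul_smul, Matrix.smul_mul,
      Matrix.mul_one, hU, map_sub, map_smul, Matrix.toLin'_one]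
    rfl
  have hdet : U.det ≠ 0 := fun h => by
    have := congrArg Matrix.det hU
    rw [Matrix.det_mul, h, zero_mul, Matrix.det_one] at this
    exact zero_ne_one this
  have hrank : (U * Matrix.diagonal (fun k => d k - μ) * Uᵀ).rank =
      Fintype.card {k // d k - μ ≠ 0} := by
    rw [Matrix.rank_mul_eq_left_of_det_ne_zero, Matrix.rank_mul_eq_right_of_det_ne_zero,
      Matrix.rank_diagonal]
    · exact hdet
    · rwa [Matrix.det_transpose]
  have hn := LinearMap.finrank_range_add_finrank_ker
    (Matrix.toLin' (U * Matrix.diagonal (fun k => d k - μ) * Uᵀ))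
  have hcard := Finset.card_filter_add_card_filter_not (s := Finset.univ) (fun k => d k = μ)
  rw [Fintype.card_subtype] at hrank
  simp only [sub_ne_zero] at hrank
  change Matrix.rank _ + _ = _ at hn
  rw [hrank, Module.finrank_fintype_fun_eq_card, ← hshift,
    ← Module.End.eigenspace_def] at hn
  rw [Finset.card_univ] at hcard
  simp only [ne_eq] at hn
  rw [multiplicity]
  omega

theorem hasEigenvalue_iff {A U : Matrix (Fin n) (Fin n) ℝ} {d : Fin n → ℝ}
    (hU : U * Uᵀ = 1) (hA : A = U * Matrix.diagonal d * Uᵀ) (μ : ℝ) :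
    Module.End.HasEigenvalue (Matrix.toLin' A) μ ↔ ∃ k, d k = μ := by
  rw [Module.End.hasEigenvalue_iff, ← Submodule.one_le_finrank_iff]
  change 0 < multiplicity A μ ↔ _
  rw [multiplicity_eq_card hU hA, Finset.card_pos]
  simp [Finset.Nonempty]

/-! ### The tangent space to the orthogonal orbit of `A`. -/

/-- Orthogonal conjugation as a linear equivalence. -/
def conjEquiv (U : Matrix (Fin n) (Fin n) ℝ) (h : U * Uᵀ = 1) (h' : Uᵀ * U = 1) :
    Matrix (Fin n) (Fin n) ℝ ≃ₗ[ℝ] Matrix (Fin n) (Fin n) ℝ where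
  toFun M := U * M * Uᵀ
  invFun M := Uᵀ * M * U
  map_add' _ _ := by rw [Matrix.mul_add, Matrix.add_mul]
  map_smul' _ _ := by rw [Matrix.mul_smul, Matrix.smul_mul]; rfl
  left_inv M := by
    simp only [Matrix.mul_assoc, h', Matrix.mul_one]
    rw [← Matrix.mul_assoc, h', Matrix.one_mul]
  right_inv M := by
    simp only [Matrix.mul_assoc, h, Matrix.mul_one]
    rw [← Matrix.mul_assoc, h, Matrix.one_mul]

/-- In the eigenbasis the commutator acts entrywise as multiplication by `d i - d j`. This factor is
antisymmetric, so it exchanges antisymmetric and symmetric matrices, and it is invertible exactly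
where the eigenvalues differ. -/
theorem orbitTangent_eq_map {A U : Matrix (Fin n) (Fin n) ℝ} {d : Fin n → ℝ}
    (hU : U * Uᵀ = 1) (hU' : Uᵀ * U = 1) (hA : A = U * Matrix.diagonal d * Uᵀ) :
    orbitTangent A = (symSupport fun i j => d i ≠ d j).map (conjEquiv U hU hU').toLinearMap := by
  have hcomm : ∀ Y, commutatorMap A (conjEquiv U hU hU' Y) =
      conjEquiv U hU hU' (Matrix.diagonal d * Y - Y * Matrix.diagonal d) := by
    intro Y
    change A * (U * Y * Uᵀ) - (U * Y * Uᵀ) * A = U * _ * Uᵀ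
    rw [Matrix.mul_sub, Matrix.sub_mul, hA]
    congr 1
    · simp only [Matrix.mul_assoc]
      rw [← Matrix.mul_assoc Uᵀ U, hU', Matrix.one_mul]
    · simp only [Matrix.mul_assoc]
      rw [← Matrix.mul_assoc Uᵀ U, hU', Matrix.one_mul]
  have hentry : ∀ (Y : Matrix (Fin n) (Fin n) ℝ) i j,
      (Matrix.diagonal d * Y - Y * Matrix.diagonal d) i j = (d i - d j) * Y i j := by
    intro Y i j
    rw [Matrix.sub_apply, Matrix.diagonal_mul, Matrix.mul_diagonal]
    ring
  ext M
  simp only [orbitTangent, Submodule.mem_map]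
  constructor
  · rintro ⟨X, hX, rfl⟩
    obtain ⟨Y, rfl⟩ := (conjEquiv U hU hU').surjective X
    have hY : Yᵀ = -Y := by
      apply (conjEquiv U hU hU').injective
      rw [map_neg]
      have : (U * Y * Uᵀ)ᵀ = -(U * Y * Uᵀ) := hX
      rw [Matrix.transpose_mul, Matrix.transpose_mul, Matrix.transpose_transpose,
        ← Matrix.mul_assoc] at this
      exact this
    refine ⟨_, ⟨?_, fun i j hij => ?_⟩, (hcomm Y).symm⟩
    · ext i j
      have : Y j i = -Y i j := congrFun (congrFun hY i) j
      rw [Matrix.transpose_apply, hentry, hentry, this]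
      ring
    · rw [hentry, not_not.1 hij, sub_self, zero_mul]
  · rintro ⟨S, hS, rfl⟩
    -- Where `d i = d j` the quotient is `0` by convention, which is harmless because `S i j = 0`
    -- there.
    set Y : Matrix (Fin n) (Fin n) ℝ := Matrix.of fun i j => S i j / (d i - d j) with hY
    refine ⟨conjEquiv U hU hU' Y, ?_, ?_⟩
    · change (U * Y * Uᵀ)ᵀ = -(U * Y * Uᵀ)
      have hYT : Yᵀ = -Y := by
        ext i j
        rw [Matrix.transpose_apply, Matrix.neg_apply, hY, Matrix.of_apply, Matrix.of_apply,
          hS.1.apply i j, ← div_neg, neg_sub]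
      rw [Matrix.transpose_mul, Matrix.transpose_mul, Matrix.transpose_transpose, hYT,
        ← Matrix.mul_assoc, Matrix.mul_neg, Matrix.neg_mul]
    · rw [hcomm]
      refine congrArg (conjEquiv U hU hU') ?_
      ext i j
      rw [hentry, hY, Matrix.of_apply]
      by_cases h : d i = d j
      · rw [h, sub_self, zero_mul, hS.2 i j (not_not.2 h)]
      · rw [mul_div_cancel₀ _ (sub_ne_zero.2 h)]

/-- Pairs `i < j` split into those with distinct eigenvalues, which index coordinates of the tangent
space, and those with equal ones. -/
theorem finrank_orbitTangent_add {A U : Matrix (Fin n) (Fin n) ℝ} {d : Fin n → ℝ}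
    (hU : U * Uᵀ = 1) (hU' : Uᵀ * U = 1) (hA : A = U * Matrix.diagonal d * Uᵀ) :
    Module.finrank ℝ (orbitTangent A) +
      (Finset.univ.filter fun p : Fin n × Fin n => p.1 < p.2 ∧ d p.1 = d p.2).card =
      n.choose 2 := by
  classical
  rw [orbitTangent_eq_map hU hU' hA, LinearEquiv.finrank_map_eq,
    finrank_symSupport _ (fun _ _ h => h.symm), ← card_lt_pairs_univ, Nat.card_eq_fintype_card,
    Nat.card_eq_fintype_card, Fintype.card_subtype, Fintype.card_subtype,
    ← Finset.card_union_of_disjoint]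
  · congr 1
    ext p
    simp only [Finset.mem_union, Finset.mem_filter, Finset.mem_univ, true_and, and_true]
    constructor
    · rintro (⟨h, h'⟩ | h)
      · exact lt_of_le_of_ne h fun e => h' (congrArg d e)
      · exact h.1
    · intro h
      by_cases e : d p.1 = d p.2
      · exact Or.inr ⟨h, e⟩
      · exact Or.inl ⟨h.le, e⟩
  · rw [Finset.disjoint_filter]
    exact fun p _ h h' => h.2 h'.2

/-! ### Grouping by distinct eigenvalues and the dimension criterion. -/

section DistinctEigenvalues

variable {A U : Matrix (Fin n) (Fin n) ℝ} {d : Fin n → ℝ} {r : ℕ} {ev : Fin r → ℝ}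

theorem sum_multiplicity (hU : U * Uᵀ = 1) (hA : A = U * Matrix.diagonal d * Uᵀ)
    (hev : Function.Injective ev) (hd : ∀ k, d k ∈ Set.range ev) :
    ∑ i, multiplicity A (ev i) = n := by
  choose c hc using hd
  have h := Finset.card_eq_sum_card_fiberwise (f := c) (s := Finset.univ) (t := Finset.univ)
    (by simp)
  rw [Finset.card_univ, Fintype.card_fin] at h
  refine (Finset.sum_congr rfl fun i _ => ?_).trans h.symm
  rw [multiplicity_eq_card hU hA]
  congr 1
  ext k
  simp [← hc, hev.eq_iff]

theorem sum_choose_multiplicity (hU : U * Uᵀ = 1) (hA : A = U * Matrix.diagonal d * Uᵀ)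
    (hev : Function.Injective ev) (hd : ∀ k, d k ∈ Set.range ev) :
    ∑ i, (multiplicity A (ev i)).choose 2 =
      (Finset.univ.filter fun p : Fin n × Fin n => p.1 < p.2 ∧ d p.1 = d p.2).card := by
  choose c hc using hd
  rw [Finset.card_eq_sum_card_fiberwise (f := fun p => c p.1) (t := Finset.univ) (by simp)]
  refine Finset.sum_congr rfl fun i _ => ?_
  rw [multiplicity_eq_card hU hA, ← card_lt_pairs]
  congr 1
  ext p
  simp only [Finset.mem_filter, Finset.mem_univ, true_and, ← hc, hev.eq_iff]
  constructor
  · rintro ⟨h, h1, h2⟩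
    exact ⟨⟨h, h1.trans h2.symm⟩, h1⟩
  · rintro ⟨⟨h, h1⟩, h2⟩
    exact ⟨h, h2, h1.symm.trans h2⟩

end DistinctEigenvalues

theorem finrank_symMatrices_le_iff {A : Matrix (Fin n) (Fin n) ℝ} (hA : A.IsSymm)
    (G : SimpleGraph (Fin n)) {r : ℕ} {ev : Fin r → ℝ} (hev : Function.Injective ev)
    (hspec : ∀ x : ℝ, Module.End.HasEigenvalue (Matrix.toLin' A) x ↔ x ∈ Set.range ev) :
    ∑ i, multiplicity A (ev i) = n ∧
      (Module.finrank ℝ (symMatrices n) ≤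
          Module.finrank ℝ (supportedOn G) + Module.finrank ℝ (orbitTangent A) ↔
        ∑ i, (multiplicity A (ev i)).choose 2 ≤ numEdges G) := by
  obtain ⟨U, d, hU, hU', hA'⟩ := exists_orthogonal_diagonalization hA
  have hd : ∀ k, d k ∈ Set.range ev := fun k =>
    (hspec _).1 ((hasEigenvalue_iff hU hA' _).2 ⟨k, rfl⟩)
  refine ⟨sum_multiplicity hU hA' hev hd, ?_⟩
  have h := finrank_orbitTangent_add hU hU' hA'
  rw [finrank_symMatrices, finrank_supportedOn, sum_choose_multiplicity hU hA' hev hd]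
  -- Both sides of the dimension inequality contain `n + n.choose 2`; cancelling it leaves the
  -- comparison of `∑ (m_i choose 2)` with `|E|`.
  omega

theorem finrank_symMatrices_le_of_transversality {A : Matrix (Fin n) (Fin n) ℝ}
    {W : Submodule ℝ (Matrix (Fin n) (Fin n) ℝ)} (h : TransversalityCondition A W) :
    Module.finrank ℝ (symMatrices n) ≤
      Module.finrank ℝ W + Module.finrank ℝ (orbitTangent A) := by
  rw [← show orbitTangent A ⊔ W = symMatrices n from h, add_comm]
  exact Submodule.finrank_add_le_finrank_add_finrank _ _

theorem transversalityCondition_iff {A : Matrix (Fin n) (Fin n) ℝ}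
    {W : Submodule ℝ (Matrix (Fin n) (Fin n) ℝ)} :
    TransversalityCondition A W ↔
      (W : Set (Matrix (Fin n) (Fin n) ℝ)) +
          {M | ∃ X ∈ antisymMatrices n, M = A * X - X * A} =
        (symMatrices n : Set (Matrix (Fin n) (Fin n) ℝ)) := by
  have h : {M | ∃ X ∈ antisymMatrices n, M = A * X - X * A} =
      (orbitTangent A : Set (Matrix (Fin n) (Fin n) ℝ)) := by
    ext M
    exact ⟨fun ⟨X, hX, h⟩ => ⟨X, hX, h.symm⟩, fun ⟨X, hX, h⟩ => ⟨X, hX, h.symm⟩⟩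
  rw [h, ← Submodule.coe_sup, SetLike.coe_set_eq, sup_comm]
  rfl

/-! ### Averages and assembly of the theorem. -/

/-- The bounds on the total nodal count in terms of averages and the first Betti number. -/
theorem averageNodalCount_bounds {G : SimpleGraph (Fin n)} {ν : Fin n → ℕ} (hn : 0 < n)
    (hlow : n.choose 2 + numEdges G + 1 ≤ ∑ k, ν k + n)
    (hup : ∑ k, ν k + n.choose 2 + numEdges G + 1 ≤ n * numEdges G + n) :
    ((betti G : ℝ) / n ≤ 1 / n * ∑ k : Fin n, ((ν k : ℝ) - ((k : ℕ) : ℝ)) ∧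
      1 / n * ∑ k : Fin n, ((ν k : ℝ) - ((k : ℕ) : ℝ)) ≤ (betti G : ℝ) - (betti G : ℝ) / n) ∧
    (((n : ℝ) - 1) / 2 + (betti G : ℝ) / n ≤ 1 / n * ∑ k : Fin n, (ν k : ℝ) ∧
      1 / n * ∑ k : Fin n, (ν k : ℝ) ≤
        ((n : ℝ) - 1) / 2 + (betti G : ℝ) - (betti G : ℝ) / n) := by
  have hn' : (0 : ℝ) < n := Nat.cast_pos.2 hn
  -- Indices start at `0`, so `k` here plays the role of `k - 1` in the nodal surplus.
  have hsum : ∑ k : Fin n, ((k : ℕ) : ℝ) = n * (n - 1) / 2 := by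
    rw [Fin.sum_univ_eq_sum_range (fun k => (k : ℝ)), ← Nat.cast_sum, Finset.sum_range_id,
      ← Nat.choose_two_right, Nat.cast_choose_two]
  have hβ : (betti G : ℝ) = numEdges G - (n - 1) := by
    rw [betti]
    push_cast
    rfl
  have hlow' : (n : ℝ) * (n - 1) / 2 + numEdges G + 1 ≤ ∑ k, (ν k : ℝ) + n := by
    rw [← Nat.cast_choose_two]
    exact_mod_cast hlow
  have hup' : ∑ k, (ν k : ℝ) + n * (n - 1) / 2 + numEdges G + 1 ≤ n * numEdges G + n := by
    rw [← Nat.cast_choose_two]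
    exact_mod_cast hup
  rw [Finset.sum_sub_distrib, hsum, hβ]
  generalize ∑ k, (ν k : ℝ) = s at hlow' hup'
  refine ⟨⟨?_, ?_⟩, ?_, ?_⟩
  · rw [one_div_mul_eq_div]
    refine div_le_div_of_nonneg_right ?_ hn'.le
    linarith
  · rw [one_div_mul_eq_div, le_sub_iff_add_le, ← add_div, div_le_iff₀ hn']
    linarith
  · rw [one_div_mul_eq_div, ← le_sub_iff_add_le, ← sub_nonneg]
    have : s / n - ((numEdges G : ℝ) - (n - 1)) / n - ((n : ℝ) - 1) / 2 =
        (s + n - (n * (n - 1) / 2 + numEdges G + 1)) / n := by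
      field_simp
      ring
    rw [this]
    exact div_nonneg (by linarith) hn'.le
  · rw [one_div_mul_eq_div, le_sub_iff_add_le, ← add_div, div_le_iff₀ hn']
    linarith

end NodalCount

theorem proposition5p6 {n : ℕ} (G : SimpleGraph (Fin n)) (hG : G.Connected)
    (A : Matrix (Fin n) (Fin n) ℝ) (hA : NodalCount.IsStrictlySupportedOn A G) :
    -- transversality implies the bounds on the average nodal surplus and average nodal count
    (NodalCount.TransversalityCondition A (NodalCount.supportedOn G) →
      ∀ φ : Module.Basis (Fin n) ℝ (Fin n → ℝ), NodalCount.IsOrthogonalEigenbasis A φ →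
        (∀ k i, φ k i ≠ 0) →
        ((NodalCount.betti G : ℝ) / n ≤
            1 / n * ∑ k : Fin n, ((NodalCount.nodalCount A (φ k) : ℝ) - ((k : ℕ) : ℝ)) ∧
          1 / n * ∑ k : Fin n, ((NodalCount.nodalCount A (φ k) : ℝ) - ((k : ℕ) : ℝ)) ≤
            (NodalCount.betti G : ℝ) - (NodalCount.betti G : ℝ) / n) ∧
        (((n : ℝ) - 1) / 2 + (NodalCount.betti G : ℝ) / n ≤
            1 / n * ∑ k : Fin n, (NodalCount.nodalCount A (φ k) : ℝ) ∧
          1 / n * ∑ k : Fin n, (NodalCount.nodalCount A (φ k) : ℝ) ≤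
            ((n : ℝ) - 1) / 2 + (NodalCount.betti G : ℝ) - (NodalCount.betti G : ℝ) / n)) ∧
    -- what the transversality condition says
    (NodalCount.TransversalityCondition A (NodalCount.supportedOn G) ↔
      (NodalCount.supportedOn G : Set (Matrix (Fin n) (Fin n) ℝ)) +
          {M | ∃ X ∈ NodalCount.antisymMatrices n, M = A * X - X * A} =
        (NodalCount.symMatrices n : Set (Matrix (Fin n) (Fin n) ℝ))) ∧
    -- the necessary condition on dimensions
    (NodalCount.TransversalityCondition A (NodalCount.supportedOn G) →
      Module.finrank ℝ (NodalCount.symMatrices n) ≤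
        Module.finrank ℝ (NodalCount.supportedOn G) +
          Module.finrank ℝ (NodalCount.orbitTangent A)) ∧
    -- the same condition in terms of the distinct eigenvalues `ev 0, …, ev (r - 1)`
    (∀ (r : ℕ) (ev : Fin r → ℝ), Function.Injective ev →
      (∀ x : ℝ, Module.End.HasEigenvalue (Matrix.toLin' A) x ↔ x ∈ Set.range ev) →
      ∑ i, NodalCount.multiplicity A (ev i) = n ∧
      (Module.finrank ℝ (NodalCount.symMatrices n) ≤
          Module.finrank ℝ (NodalCount.supportedOn G) +
            Module.finrank ℝ (NodalCount.orbitTangent A) ↔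
        ∑ i, (NodalCount.multiplicity A (ev i)).choose 2 ≤ NodalCount.numEdges G) ∧
      (NodalCount.TransversalityCondition A (NodalCount.supportedOn G) →
        ∑ i, (NodalCount.multiplicity A (ev i)).choose 2 ≤ NodalCount.numEdges G)) ∧
    ((NodalCount.numEdges G : ℤ) = NodalCount.betti G - 1 + n) := by
  have hn : 0 < n := by
    obtain ⟨o⟩ := hG.nonempty
    exact o.pos
  refine ⟨fun _ φ hφ hφ0 => ?_, NodalCount.transversalityCondition_iff,
    NodalCount.finrank_symMatrices_le_of_transversality, fun r ev hev hspec => ?_, ?_⟩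
  · exact NodalCount.averageNodalCount_bounds hn
      (NodalCount.choose_two_add_numEdges_le_sum_nodalCount hG hA hφ hφ0)
      (NodalCount.sum_nodalCount_le hG hA hφ hφ0)
  · obtain ⟨h1, h2⟩ := NodalCount.finrank_symMatrices_le_iff hA.1.1 G hev hspec
    exact ⟨h1, h2, fun h => h2.1 (NodalCount.finrank_symMatrices_le_of_transversality h)⟩
  · rw [NodalCount.betti]
    ring
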